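/- Let $X$ be a real Hausdorff locally convex space with topological dual $X^*$. On $\overline{\mathbb R}=\mathbb R\cup\{-\infty,+\infty\}$ use the conventions $(+\infty)+(-\infty)=(-\infty)+(+\infty)=+\infty$, $0\cdot(+\infty)=+\infty$, $0\cdot(-\infty)=0$. For $g:X\to\overline{\mathbb R}$ put $\operatorname{dom} g=\{x\in X: g(x)<+\infty\}$ and $\operatorname{epi} g=\{(x,r)\in X\times\mathbb R: g(x)\le r\}$; $g$ is convex (respectively lower semicontinuous) if $\operatorname{epi} g$ is convex (respectively closed), and proper if $\operatorname{dom} g\ne\emptyset$ and $g>-\infty$ on $X$. For $\eta\in\overline{\mathbb R}$ and $x\in X$ let $$\partial_\eta g(x)=\{x^*\in X^*: g(y)\ge g(x)+\langle x^*,y-x\rangle-\eta\ \text{ for all } y\in X\}$$ if $x\in\operatorname{dom} g$ and $\eta\ge 0$, let $\partial_\eta g(x)=\emptyset$ otherwise, and write $\partial g(x)=\partial_0 g(x)$. Let $n\ge 1$, let $f_1,\dots,f_n:X\to\overline{\mathbb R}$ be convex functions, let $f=\max_{1\le k\le n} f_k$, and suppose that $\operatorname{dom} f\neq\emptyset$.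 Assume that all the $f_k$ are proper, or that all the $f_k$ are lower semicontinuous. Let $\Delta_n=\{\lambda\in\mathbb R^n:\lambda_k\ge 0,\ \sum_{k=1}^n\lambda_k=1\}$ and, for $\lambda\in\Delta_n$, $f_\lambda=\sum_{k=1}^n\lambda_k f_k$. Then for every $x\in X$ and every real $\varepsilon\ge 0$, $$\partial_\varepsilon f(x)=\bigcup_{\lambda\in\Delta_n}\partial_{\varepsilon+f_\lambda(x)-f(x)}\,f_\lambda(x).$$ In particular, for every $x\in X$, $$\partial f(x)=\bigcup\{\partial f_\lambda(x):\ \lambda\in\Delta_n,\ f_\lambda(x)=f(x)\}.$$ -/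

import Mathlib

namespace MaxSubdiff

/-- Addition on the extended reals with the convention `(+∞) + (-∞) = (-∞) + (+∞) = +∞`
(the addition of `EReal` in Mathlib has the opposite convention). -/
noncomputable def eadd (a b : EReal) : EReal :=
  open Classical in if a = ⊤ ∨ b = ⊤ then ⊤ else a + b

/-- Multiplication of an extended real by a real with the conventions
`0 · (+∞) = +∞` and `0 · (-∞) = 0`. -/
noncomputable def esmul (t : ℝ) (a : EReal) : EReal :=
  open Classical in if t = 0 ∧ a = ⊤ then ⊤ else (t : EReal) * a

theorem eadd_eq_top {a b : EReal} : eadd a b = ⊤ ↔ a = ⊤ ∨ b = ⊤ := by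
  unfold eadd
  split_ifs with h
  · simp [h]
  · push Not at h
    simp [h.1, h.2, EReal.add_ne_top h.1 h.2]

instance instCommutativeEadd : Std.Commutative eadd :=
  ⟨fun a b => by simp only [eadd, or_comm, add_comm]⟩

instance instAssociativeEadd : Std.Associative eadd :=
  ⟨fun a b c => by
    by_cases h : a = ⊤ ∨ b = ⊤ ∨ c = ⊤
    · rw [eadd_eq_top.2 (by rw [eadd_eq_top]; tauto), eadd_eq_top.2 (by rw [eadd_eq_top]; tauto)]
    · push Not at h
      obtain ⟨ha, hb, hc⟩ := h
      simp [eadd, ha, hb, hc, EReal.add_ne_top, add_assoc]⟩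

section Functions

variable {X : Type*}

/-- The effective domain. -/
def edom (f : X → EReal) : Set X := {x | f x < ⊤}

/-- The epigraph, a subset of `X × ℝ`. -/
def epi (f : X → EReal) : Set (X × ℝ) := {p | f p.1 ≤ (p.2 : EReal)}

/-- Properness: non-empty effective domain, and the value `-∞` is not taken. -/
def IsProper (f : X → EReal) : Prop := (edom f).Nonempty ∧ ∀ x, ⊥ < f x

/-- Convexity: the epigraph is convex. -/
def IsConvexFun [AddCommGroup X] [Module ℝ X] (f : X → EReal) : Prop := Convex ℝ (epi f)

/-- Lower semicontinuity: the epigraph is closed. -/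
def IsLsc [TopologicalSpace X] (f : X → EReal) : Prop := IsClosed (epi f)

/-- The pointwise maximum `max_k f_k` of a finite family. -/
noncomputable def maxFun {n : ℕ} (f : Fin n → X → EReal) (x : X) : EReal := ⨆ k, f k x

/-- The combination `∑_k l_k f_k`, computed with the operations `eadd` and `esmul`. -/
noncomputable def combFun {n : ℕ} (f : Fin n → X → EReal) (l : Fin n → ℝ) (x : X) : EReal :=
  Finset.univ.fold eadd 0 (fun k => esmul (l k) (f k x))

/-- The `ε`-subdifferential of `f` at `x`: the continuous linear functionals `p` with
`f y ≥ f x + p (y - x) - ε` for all `y`; it is empty if `f x = +∞` or `ε < 0`.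
The parameter `ε` is an extended real. -/
def epsSubdiff [AddCommGroup X] [Module ℝ X] [TopologicalSpace X]
    (ε : EReal) (f : X → EReal) (x : X) : Set (X →L[ℝ] ℝ) :=
  {p | x ∈ edom f ∧ 0 ≤ ε ∧ ∀ y, eadd (eadd (f x) ((p (y - x) : ℝ) : EReal)) (-ε) ≤ f y}

/-- The subdifferential. -/
def subdiff [AddCommGroup X] [Module ℝ X] [TopologicalSpace X]
    (f : X → EReal) (x : X) : Set (X →L[ℝ] ℝ) :=
  epsSubdiff 0 f x

end Functions

end MaxSubdiff

/-!
A real number `r` dominates `f_λ y = ∑ λ_k f_k y` if and only if `r ≥ ∑ λ_k s_k` for some real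
`s_k ≥ f_k y`: this is what the conventions on `+∞` and `-∞` achieve, and it turns every question
about `f_λ` into one about real upper bounds.

If a concave real function `g` satisfies `g ≤ max f_k`, the set of the vectors `s - g y` with
`s_k ≥ f_k y` is convex and none of its points has only negative coordinates, so the minimax
theorem yields `λ ∈ Δ_n` with `∑ λ_k r_k ≥ 0` on it, that is, `g ≤ f_λ`. For
`g y = f x + p (y - x) - ε` the inequality `g ≤ f` says that `p ∈ ∂_ε f(x)`, and `g ≤ f_λ` says
that `p` is an approximate subgradient of `f_λ` at `x` with the error `ε + f_λ x - f x`.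
-/

namespace MaxSubdiff

theorem eadd_coe (a b : ℝ) : eadd a b = ((a + b : ℝ) : EReal) := by
  simp [eadd]

theorem eadd_zero (a : EReal) : eadd a 0 = a := by
  by_cases ha : a = ⊤ <;> simp [eadd, ha]

theorem bot_eadd {a : EReal} (ha : a ≠ ⊤) : eadd ⊥ a = ⊥ := by
  simp [eadd, ha]

theorem eadd_bot {a : EReal} (ha : a ≠ ⊤) : eadd a ⊥ = ⊥ := by
  simp [eadd, ha]

theorem eadd_le_coe_iff {a b : EReal} {r : ℝ} :
    eadd a b ≤ r ↔ ∃ s t : ℝ, a ≤ s ∧ b ≤ t ∧ s + t ≤ r := by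
  constructor
  · intro h
    have hab : ¬(a = ⊤ ∨ b = ⊤) := fun hab => by simp [eadd_eq_top.2 hab] at h
    induction a with
    | top => simp at hab
    | bot =>
      exact ⟨r - b.toReal, b.toReal, bot_le, EReal.le_coe_toReal (not_or.1 hab).2, by simp⟩
    | coe a =>
      induction b with
      | top => simp at hab
      | bot => exact ⟨a, r - a, le_rfl, bot_le, by simp⟩
      | coe b =>
        rw [eadd_coe, EReal.coe_le_coe_iff] at h
        exact ⟨a, b, le_rfl, le_rfl, h⟩
  · rintro ⟨s, t, ha, hb, hst⟩
    have hab : ¬(a = ⊤ ∨ b = ⊤) := by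
      rintro (rfl | rfl) <;> simp at ha hb
    calc eadd a b = a + b := if_neg hab
      _ ≤ s + t := add_le_add ha hb
      _ ≤ r := by exact_mod_cast hst

theorem esmul_le_coe_iff {t : ℝ} (ht : 0 ≤ t) {a : EReal} {r : ℝ} :
    esmul t a ≤ r ↔ ∃ s : ℝ, a ≤ s ∧ t * s ≤ r := by
  rcases ht.eq_or_lt with rfl | ht
  · by_cases ha : a = ⊤
    · simp [esmul, ha]
    · have hbound : ∃ s : ℝ, a ≤ s := ⟨a.toReal, EReal.le_coe_toReal ha⟩
      simp [esmul, ha, hbound]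
  · simp only [esmul, ht.ne', false_and, if_false]
    induction a with
    | top => simp [EReal.coe_mul_top_of_pos ht]
    | bot => simpa [EReal.coe_mul_bot_of_pos ht] using ⟨r / t, (mul_div_cancel₀ r ht.ne').le⟩
    | coe a =>
      simp only [← EReal.coe_mul, EReal.coe_le_coe_iff]
      exact ⟨fun h => ⟨a, le_rfl, h⟩,
        fun ⟨s, has, hs⟩ => (mul_le_mul_of_nonneg_left has ht.le).trans hs⟩

theorem fold_eadd_le_coe_iff {ι : Type*} (A : Finset ι) {a : ι → EReal} {r : ℝ} :
    A.fold eadd 0 a ≤ r ↔ ∃ s : ι → ℝ, (∀ i ∈ A, a i ≤ s i) ∧ ∑ i ∈ A, s i ≤ r := by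
  classical
  induction A using Finset.induction_on generalizing r with
  | empty => simp
  | insert i A hi ih =>
    rw [Finset.fold_insert hi, eadd_le_coe_iff]
    simp only [Finset.forall_mem_insert, Finset.sum_insert hi]
    constructor
    · rintro ⟨u, v, hu, hv, huv⟩
      obtain ⟨s, hs, hsv⟩ := ih.1 hv
      have hupdate : ∀ j ∈ A, Function.update s i u j = s j := fun j hj =>
        Function.update_of_ne (ne_of_mem_of_not_mem hj hi) _ _
      refine ⟨Function.update s i u, ⟨by simpa using hu, fun j hj => ?_⟩, ?_⟩
      · rw [hupdate j hj]
        exact hs j hj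
      · rw [Function.update_self, Finset.sum_congr rfl hupdate]
        linarith
    · rintro ⟨s, ⟨hi, hs⟩, hsum⟩
      exact ⟨s i, ∑ j ∈ A, s j, hi, ih.2 ⟨s, hs, le_rfl⟩, hsum⟩

theorem dotProduct_const_of_mem_stdSimplex {ι : Type*} [Fintype ι] {l : ι → ℝ}
    (hl : l ∈ stdSimplex ℝ ι) (c : ℝ) : (l ⬝ᵥ fun _ => c) = c := by
  rw [dotProduct, ← Finset.sum_mul, hl.2, one_mul]

section Combination

variable {X : Type*} {n : ℕ} {f : Fin n → X → EReal} {l : Fin n → ℝ}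

theorem combFun_le_coe_iff (hl : ∀ k, 0 ≤ l k) {y : X} {r : ℝ} :
    combFun f l y ≤ r ↔ ∃ s : Fin n → ℝ, (∀ k, f k y ≤ s k) ∧ l ⬝ᵥ s ≤ r := by
  simp only [combFun, fold_eadd_le_coe_iff, Finset.mem_univ, true_imp_iff,
    esmul_le_coe_iff (hl _)]
  constructor
  · rintro ⟨t, ht, htr⟩
    choose s hs hst using ht
    exact ⟨s, hs, (Finset.sum_le_sum fun k _ => hst k).trans htr⟩
  · rintro ⟨s, hs, hsr⟩
    exact ⟨fun k => l k * s k, fun k => ⟨s k, hs k, le_rfl⟩, hsr⟩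

theorem combFun_le_maxFun (hl : l ∈ stdSimplex ℝ (Fin n)) (y : X) :
    combFun f l y ≤ maxFun f y := by
  refine EReal.le_of_forall_lt_iff_le.1 fun M hM => (combFun_le_coe_iff hl.1).2 ?_
  exact ⟨fun _ => M, iSup_le_iff.1 hM.le, (dotProduct_const_of_mem_stdSimplex hl M).le⟩

end Combination

theorem exists_stdSimplex_dotProduct_nonneg {ι : Type*} [Fintype ι] [Nonempty ι]
    {C : Set (ι → ℝ)} (hC : Convex ℝ C) (hnonneg : ∀ r ∈ C, ∃ k, 0 ≤ r k) :
    ∃ l ∈ stdSimplex ℝ ι, ∀ r ∈ C, 0 ≤ l ⬝ᵥ r := by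
  classical
  by_contra! hlt
  have hsimplex : (stdSimplex ℝ ι).Nonempty :=
    ⟨_, single_mem_stdSimplex ℝ (Classical.arbitrary ι)⟩
  -- The minimax theorem asks for finitely many `r`; compactness of the simplex provides them.
  obtain ⟨S, hSC, hS, hcover⟩ := (isCompact_stdSimplex ℝ ι).elim_finite_subcover_image
    (b := C) (c := fun r => {l | l ⬝ᵥ r < 0})
    (fun r _ => isOpen_lt (by fun_prop) continuous_const)
    (fun l hl => by simpa using hlt l hl)
  obtain ⟨r, hr, hneg⟩ := Sion.exists_lt_iInf_of_lt_iInf_of_finite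
    (f := fun l r : ι → ℝ => -(l ⬝ᵥ r)) (t := 0) hsimplex (isCompact_stdSimplex ℝ ι)
    (fun r _ => ContinuousOn.lowerSemicontinuousOn (by fun_prop))
    (fun r _ =>
      ((dotProductBilin ℝ ℝ).flip r).concaveOn (convex_stdSimplex ℝ ι) |>.neg.quasiconvexOn)
    hC
    (fun l _ => ContinuousOn.upperSemicontinuousOn (by fun_prop))
    (fun l _ => (dotProductBilin ℝ ℝ l).convexOn hC |>.neg.quasiconcaveOn)
    (convex_stdSimplex ℝ ι) hS hSC
    (fun l hl => by simpa using hcover hl)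
  obtain ⟨k, hk⟩ := hnonneg r hr
  have hrk : 0 < -(Pi.single k 1 ⬝ᵥ r) := hneg _ (single_mem_stdSimplex ℝ k)
  rw [single_one_dotProduct] at hrk
  linarith

section Sandwich

variable {X : Type*} [AddCommGroup X] [Module ℝ X] {g : X → ℝ}

theorem convex_setOf_exists_forall_le_coe_add {ι : Type*} {f : ι → X → EReal}
    (hf : ∀ k, IsConvexFun (f k)) (hg : ConcaveOn ℝ Set.univ g) :
    Convex ℝ {r : ι → ℝ | ∃ y, ∀ k, f k y ≤ ((r k + g y : ℝ) : EReal)} := by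
  rintro r ⟨y, hy⟩ s ⟨z, hz⟩ α β hα hβ hαβ
  refine ⟨α • y + β • z, fun k => ?_⟩
  have hepi : f k (α • y + β • z) ≤ ((α * (r k + g y) + β * (s k + g z) : ℝ) : EReal) :=
    hf k (x := (y, r k + g y)) (hy k) (y := (z, s k + g z)) (hz k) hα hβ hαβ
  have hconc : α * g y + β * g z ≤ g (α • y + β • z) :=
    hg.2 (Set.mem_univ y) (Set.mem_univ z) hα hβ hαβ
  refine hepi.trans (EReal.coe_le_coe_iff.2 ?_)
  simp only [Pi.add_apply, Pi.smul_apply, smul_eq_mul]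
  linarith

variable {n : ℕ} {f : Fin n → X → EReal}

theorem exists_stdSimplex_coe_le_combFun (hn : 1 ≤ n) (hf : ∀ k, IsConvexFun (f k))
    (hg : ConcaveOn ℝ Set.univ g) (hle : ∀ y, (g y : EReal) ≤ maxFun f y) :
    ∃ l ∈ stdSimplex ℝ (Fin n), ∀ y, (g y : EReal) ≤ combFun f l y := by
  have : Nonempty (Fin n) := ⟨⟨0, hn⟩⟩
  obtain ⟨l, hl, hnonneg⟩ := exists_stdSimplex_dotProduct_nonneg
    (convex_setOf_exists_forall_le_coe_add hf hg) (by
      rintro r ⟨y, hy⟩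
      obtain ⟨k, hk⟩ := exists_eq_ciSup_of_finite (f := fun k => f k y)
      have hgr : (g y : EReal) ≤ ((r k + g y : ℝ) : EReal) := (hle y).trans (hk.ge.trans (hy k))
      exact ⟨k, by simpa using EReal.coe_le_coe_iff.1 hgr⟩)
  refine ⟨l, hl, fun y => EReal.le_of_forall_lt_iff_le.1 fun z hz => ?_⟩
  obtain ⟨s, hs, hsz⟩ := (combFun_le_coe_iff hl.1).1 hz.le
  have hdot : 0 ≤ l ⬝ᵥ (s - fun _ => g y) :=
    hnonneg _ ⟨y, fun k => by simpa using hs k⟩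
  rw [dotProduct_sub, dotProduct_const_of_mem_stdSimplex hl] at hdot
  exact EReal.coe_le_coe_iff.2 (by linarith)

end Sandwich

section Subdifferential

variable {X : Type*} [AddCommGroup X] [Module ℝ X] [TopologicalSpace X] {x : X} {p : X →L[ℝ] ℝ}

theorem exists_stdSimplex_eadd_le_combFun {n : ℕ} (hn : 1 ≤ n) {f : Fin n → X → EReal}
    (hf : ∀ k, IsConvexFun (f k)) {b : EReal} (hb : b ≠ ⊤) {ε : ℝ}
    (hle : ∀ y, eadd (eadd b (p (y - x) : ℝ)) (-ε) ≤ maxFun f y) :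
    ∃ l ∈ stdSimplex ℝ (Fin n), ∀ y, eadd (eadd b (p (y - x) : ℝ)) (-ε) ≤ combFun f l y := by
  simp only [← EReal.coe_neg] at hle ⊢
  induction b with
  | top => exact absurd rfl hb
  | bot =>
    refine ⟨_, single_mem_stdSimplex ℝ (⟨0, hn⟩ : Fin n), fun y => ?_⟩
    rw [bot_eadd (EReal.coe_ne_top _), bot_eadd (EReal.coe_ne_top _)]
    exact bot_le
  | coe c =>
    have hconc : ConcaveOn ℝ Set.univ fun y => c + p (y - x) + -ε := by
      convert! ((p : X →ₗ[ℝ] ℝ).concaveOn convex_univ).add_const (c - p x - ε) using 2 with y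
      simp only [map_sub, Pi.add_apply, ContinuousLinearMap.coe_coe]
      ring
    simp only [eadd_coe] at hle ⊢
    exact exists_stdSimplex_coe_le_combFun hn hf hconc hle

variable {g : X → EReal} {b : EReal}

theorem notMem_epsSubdiff_bot : p ∉ epsSubdiff ⊥ g x := fun h => by
  simpa using h.2.1

theorem mem_epsSubdiff_of_eq_bot {ε : EReal} (hx : g x = ⊥) (hε : 0 ≤ ε) :
    p ∈ epsSubdiff ε g x := by
  refine ⟨by simp [edom, hx], hε, fun y => ?_⟩
  have hε_neg : -ε ≠ ⊤ := fun h => by simp [EReal.neg_eq_top_iff.1 h] at hε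
  rw [hx, bot_eadd (EReal.coe_ne_top _), bot_eadd hε_neg]
  exact bot_le

theorem mem_epsSubdiff_coe_iff {a ε : ℝ} (hx : g x = a) :
    p ∈ epsSubdiff ε g x ↔ 0 ≤ ε ∧ ∀ y, ((a + p (y - x) + -ε : ℝ) : EReal) ≤ g y := by
  simp only [epsSubdiff, edom, Set.mem_ofPred_eq, hx, EReal.coe_lt_top, true_and,
    EReal.coe_nonneg, ← EReal.coe_neg, eadd_coe]

theorem mem_epsSubdiff_eadd_neg_iff {ε : ℝ} (hb : g x ≤ b) :
    p ∈ epsSubdiff (eadd (eadd ε (g x)) (-b)) g x ↔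
      b < ⊤ ∧ ∀ y, eadd (eadd b (p (y - x) : ℝ)) (-ε) ≤ g y := by
  rw [← EReal.coe_neg]
  induction b with
  | top =>
    refine iff_of_false (fun h => ?_) fun h => lt_irrefl _ h.1
    have hx : g x < ⊤ := h.1
    rw [EReal.neg_top, eadd_bot (by simpa [eadd_eq_top] using hx.ne)] at h
    exact notMem_epsSubdiff_bot h
  | bot =>
    have hx : g x = ⊥ := le_bot_iff.1 hb
    refine iff_of_true (mem_epsSubdiff_of_eq_bot hx (by simp [eadd])) ⟨bot_lt_top, fun y => ?_⟩
    rw [bot_eadd (EReal.coe_ne_top _), bot_eadd (EReal.coe_ne_top _)]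
    exact bot_le
  | coe c =>
    simp only [← EReal.coe_neg, eadd_coe, EReal.coe_lt_top, true_and]
    induction hx : g x with
    | top => simp [hx] at hb
    | bot =>
      refine iff_of_false (fun h => ?_) fun h => ?_
      · rw [eadd_bot (EReal.coe_ne_top _), bot_eadd (EReal.coe_ne_top _)] at h
        exact notMem_epsSubdiff_bot h
      · exact EReal.coe_ne_bot _ (le_bot_iff.1 (hx ▸ h x))
    | coe a =>
      have hshift : ∀ y, a + p (y - x) + -(ε + a + -c) = c + p (y - x) + -ε := fun y => by ring
      simp only [eadd_coe, mem_epsSubdiff_coe_iff hx, hshift, and_iff_right_iff_imp]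
      intro h
      have hcx : c + p (x - x) + -ε ≤ a := EReal.coe_le_coe_iff.1 (hx ▸ h x)
      rw [sub_self, map_zero] at hcx
      linarith

theorem mem_epsSubdiff_zero_eadd_neg_iff (hb : g x ≤ b) :
    p ∈ epsSubdiff (eadd (eadd 0 (g x)) (-b)) g x ↔ g x = b ∧ p ∈ subdiff g x := by
  rw [← EReal.coe_zero, mem_epsSubdiff_eadd_neg_iff hb]
  constructor
  · rintro ⟨hb_top, h⟩
    have hgx : g x = b := hb.antisymm (by simpa [eadd_zero] using h x)
    exact ⟨hgx, hb.trans_lt hb_top, le_rfl, hgx ▸ h⟩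
  · rintro ⟨rfl, hx, -, h⟩
    exact ⟨hx, h⟩

variable {n : ℕ} {f : Fin n → X → EReal}

theorem epsSubdiff_maxFun (hn : 1 ≤ n) (hf : ∀ k, IsConvexFun (f k)) {ε : ℝ} (hε : 0 ≤ ε) :
    epsSubdiff ε (maxFun f) x = ⋃ l ∈ stdSimplex ℝ (Fin n),
      epsSubdiff (eadd (eadd ε (combFun f l x)) (-maxFun f x)) (combFun f l) x := by
  ext p
  simp only [Set.mem_iUnion, exists_prop]
  constructor
  · rintro ⟨hx, -, hle⟩
    obtain ⟨l, hl, hle⟩ := exists_stdSimplex_eadd_le_combFun hn hf hx.ne hle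
    exact ⟨l, hl, (mem_epsSubdiff_eadd_neg_iff (combFun_le_maxFun hl x)).2 ⟨hx, hle⟩⟩
  · rintro ⟨l, hl, hp⟩
    obtain ⟨hx, hle⟩ := (mem_epsSubdiff_eadd_neg_iff (combFun_le_maxFun hl x)).1 hp
    exact ⟨hx, EReal.coe_nonneg.2 hε, fun y => (hle y).trans (combFun_le_maxFun hl y)⟩

theorem subdiff_maxFun (hn : 1 ≤ n) (hf : ∀ k, IsConvexFun (f k)) :
    subdiff (maxFun f) x =
      ⋃ l ∈ {l | l ∈ stdSimplex ℝ (Fin n) ∧ combFun f l x = maxFun f x},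
        subdiff (combFun f l) x := by
  ext p
  rw [subdiff, ← EReal.coe_zero, epsSubdiff_maxFun hn hf le_rfl]
  simp only [Set.mem_iUnion, exists_prop, Set.mem_ofPred_eq, and_assoc]
  exact exists_congr fun l => and_congr_right fun hl =>
    mem_epsSubdiff_zero_eadd_neg_iff (combFun_le_maxFun hl x)

end Subdifferential

end MaxSubdiff

open MaxSubdiff in
theorem mainTheorem5_general {X : Type*} [AddCommGroup X] [Module ℝ X] [TopologicalSpace X]
    (n : ℕ) (hn : 1 ≤ n) (f : Fin n → X → EReal) (hconv : ∀ k, IsConvexFun (f k)) (x : X) :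
    (∀ ε : ℝ, 0 ≤ ε →
      epsSubdiff ε (maxFun f) x = ⋃ l ∈ stdSimplex ℝ (Fin n),
        epsSubdiff (eadd (eadd ε (combFun f l x)) (-maxFun f x)) (combFun f l) x) ∧
    subdiff (maxFun f) x =
      ⋃ l ∈ {l | l ∈ stdSimplex ℝ (Fin n) ∧ combFun f l x = maxFun f x},
        subdiff (combFun f l) x :=
  ⟨fun _ hε => epsSubdiff_maxFun hn hconv hε, subdiff_maxFun hn hconv⟩

theorem mainTheorem5 {X : Type*} [AddCommGroup X] [Module ℝ X] [TopologicalSpace X]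
    [IsTopologicalAddGroup X] [ContinuousSMul ℝ X] [LocallyConvexSpace ℝ X] [T2Space X]
    (n : ℕ) (hn : 1 ≤ n) (f : Fin n → X → EReal)
    (hconv : ∀ k, MaxSubdiff.IsConvexFun (f k))
    (hdom : (MaxSubdiff.edom (MaxSubdiff.maxFun f)).Nonempty)
    (hf : (∀ k, MaxSubdiff.IsProper (f k)) ∨ (∀ k, MaxSubdiff.IsLsc (f k)))
    (x : X) :
    (∀ ε : ℝ, 0 ≤ ε →
      MaxSubdiff.epsSubdiff (ε : EReal) (MaxSubdiff.maxFun f) x =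
        ⋃ l ∈ stdSimplex ℝ (Fin n),
          MaxSubdiff.epsSubdiff
            (MaxSubdiff.eadd (MaxSubdiff.eadd (ε : EReal) (MaxSubdiff.combFun f l x))
              (-(MaxSubdiff.maxFun f x)))
            (MaxSubdiff.combFun f l) x) ∧
    MaxSubdiff.subdiff (MaxSubdiff.maxFun f) x =
      ⋃ l ∈ {l | l ∈ stdSimplex ℝ (Fin n) ∧
          MaxSubdiff.combFun f l x = MaxSubdiff.maxFun f x},
        MaxSubdiff.subdiff (MaxSubdiff.combFun f l) x :=
  mainTheorem5_general n hn f hconv x
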